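/- Let $G$ be a finitely generated group that is residually torsion-free nilpotent: there are normal subgroups $G=N_0\supseteq N_1\supseteq\cdots$ with every $G/N_k$ torsion-free nilpotent and $\bigcap_k N_k=\{1\}$. Let $\gamma_1(G)=G$, $\gamma_{n+1}(G)=[\gamma_n(G),G]$ be the lower central series, and let $$G_n=\{x\in G\mid x^k\in\gamma_n(G)\text{ for some }k\ge 1\}\qquad(n\ge1)$$ be the isolators of its terms; these are normal subgroups with $\bigcap_n G_n=\{1\}$. Choose arbitrarily a total bi-invariant group order on each quotient $G_n/G_{n+1}$, and order $G$ by declaring $x\neq 1$ positive if and only if, for the unique $n$ with $x\in G_n\setminus G_{n+1}$, the class $xG_{n+1}$ is greater than $1$ in $G_n/G_{n+1}$ (and $x<y$ if and only if $x^{-1}y$ is positive); this is a bi-invariant total order on $G$. Let $\mathbb{Q}\langle G\rangle$ be the Mal'cev--Neumann ring of all formal series $\sum_{g\in G}a_g g$ with $a_g\in\mathbb{Q}$ whose support is well-ordered, with the convolution product. For $n\ge1$ let $\mathbb{Q}[G_n]\langle G/G_n\rangle$ be the set of all formal series of the form $\sum_{t\in T}\lambda_t t$, where $T$ is a well-ordered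 subset of some transversal of $G_n$ in $G$ and $\lambda_t\in\mathbb{Q}[G_n]$ for every $t\in T$. Then $$S(G)=\bigcup_{n\ge 1}\mathbb{Q}[G_n]\langle G/G_n\rangle$$ is a subring of $\mathbb{Q}\langle G\rangle$ and is a division ring: $S(G)\ne 0$, and every nonzero element of $S(G)$ has a two-sided inverse lying in $S(G)$. -/

import Mathlib

open Set

/-! ### Isolators of the lower central series -/

section Isolators

open scoped commutatorElement

variable {G : Type*} [Group G]

theorem commutator_pow_eq_one {x g : G} {k : ℕ} (hc : Commute ⁅x, g⁆ x)
    (hk : Commute (x ^ k) g) : ⁅x, g⁆ ^ k = 1 := by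
  have h1 : g * x * g⁻¹ = ⁅x, g⁆⁻¹ * x := by
    rw [commutatorElement_def]; group
  have h2 : g * x ^ k * g⁻¹ = (⁅x, g⁆⁻¹) ^ k * x ^ k := by
    rw [← conj_pow, h1, (hc.inv_left).mul_pow]
  rw [← hk.eq, mul_inv_cancel_right] at h2
  have h3 : (⁅x, g⁆⁻¹) ^ k = 1 := by
    have := h2.symm
    rwa [mul_eq_right] at this
  rwa [inv_pow, inv_eq_one] at h3

theorem commute_mk_of_mem_lowerCentralSeries {n : ℕ} {x : G}
    (hx : x ∈ (⊤ : Subgroup G).lowerCentralSeries n) (g : G) :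
    Commute (x : G ⧸ (⊤ : Subgroup G).lowerCentralSeries (n + 1)) (g : G ⧸ _) := by
  rw [← commutatorElement_eq_one_iff_commute]
  have h : ⁅x, g⁆ ∈ (⊤ : Subgroup G).lowerCentralSeries (n + 1) :=
    Subgroup.commutator_mem_commutator hx (Subgroup.mem_top g)
  have h2 := (QuotientGroup.eq_one_iff (N := (⊤ : Subgroup G).lowerCentralSeries (n + 1)) _).2 h
  exact h2

theorem isOfFinOrder_mk_of_mem_lowerCentralSeries {S : Set G} (hS : Subgroup.closure S = ⊤)
    (hfin : ∀ s ∈ S, IsOfFinOrder s) (n : ℕ) : ∀ x ∈ (⊤ : Subgroup G).lowerCentralSeries n,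
    IsOfFinOrder (x : G ⧸ (⊤ : Subgroup G).lowerCentralSeries (n + 1)) := by
  induction n with
  | zero =>
    intro x hx
    have hx' : x ∈ Subgroup.closure S := hS ▸ Subgroup.mem_top x
    induction hx' using Subgroup.closure_induction with
    | mem s hs => exact (QuotientGroup.mk' _).isOfFinOrder (hfin s hs)
    | one => exact IsOfFinOrder.one
    | mul a b _ _ ha hb =>
      exact Commute.isOfFinOrder_mul (commute_mk_of_mem_lowerCentralSeries (Subgroup.mem_top _) _)
        (ha (Subgroup.mem_top _)) (hb (Subgroup.mem_top _))
    | inv a _ ha => exact (ha (Subgroup.mem_top _)).inv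
  | succ n ih =>
    intro x hx
    have hx' : x ∈ Subgroup.closure
        {x | ∃ p ∈ (⊤ : Subgroup G).lowerCentralSeries n, ∃ q ∈ (⊤ : Subgroup G), ⁅p, q⁆ = x} := hx
    have key : x ∈ (⊤ : Subgroup G).lowerCentralSeries (n + 1) ∧
        IsOfFinOrder (x : G ⧸ (⊤ : Subgroup G).lowerCentralSeries (n + 1 + 1)) := by
      clear hx
      induction hx' using Subgroup.closure_induction with
      | mem s hs =>
        obtain ⟨p, hp, q, hq, rfl⟩ := hs
        have hmem : ⁅p, q⁆ ∈ (⊤ : Subgroup G).lowerCentralSeries (n + 1) :=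
          Subgroup.commutator_mem_commutator hp hq
        refine ⟨hmem, ?_⟩
        obtain ⟨k, hk0, hk⟩ := isOfFinOrder_iff_pow_eq_one.1 (ih p hp)
        rw [← QuotientGroup.mk_pow, QuotientGroup.eq_one_iff] at hk
        refine isOfFinOrder_iff_pow_eq_one.2 ⟨k, hk0, ?_⟩
        exact commutator_pow_eq_one
          (x := (p : G ⧸ (⊤ : Subgroup G).lowerCentralSeries (n + 1 + 1))) (g := (q : G ⧸ _))
          (commute_mk_of_mem_lowerCentralSeries hmem p)
          (commute_mk_of_mem_lowerCentralSeries hk q)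
      | one => exact ⟨Subgroup.one_mem _, IsOfFinOrder.one⟩
      | mul a b _ _ ha hb =>
        exact ⟨Subgroup.mul_mem _ ha.1 hb.1,
          Commute.isOfFinOrder_mul (commute_mk_of_mem_lowerCentralSeries ha.1 _) ha.2 hb.2⟩
      | inv a _ ha => exact ⟨Subgroup.inv_mem _ ha.1, ha.2.inv⟩
    exact key.2

theorem isOfFinOrder_of_closure_eq_top [Group.IsNilpotent G] {S : Set G}
    (hS : Subgroup.closure S = ⊤) (hfin : ∀ s ∈ S, IsOfFinOrder s) (x : G) : IsOfFinOrder x := by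
  have h : ∀ n : ℕ, ∃ k : ℕ, 0 < k ∧ x ^ k ∈ (⊤ : Subgroup G).lowerCentralSeries n := by
    intro n
    induction n with
    | zero => exact ⟨1, one_pos, Subgroup.mem_top _⟩
    | succ n ih =>
      obtain ⟨k, hk, hx⟩ := ih
      obtain ⟨l, hl, hxl⟩ := isOfFinOrder_iff_pow_eq_one.1
        (isOfFinOrder_mk_of_mem_lowerCentralSeries hS hfin n _ hx)
      refine ⟨k * l, Nat.mul_pos hk hl, ?_⟩
      rwa [← QuotientGroup.mk_pow, QuotientGroup.eq_one_iff, ← pow_mul] at hxl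
  obtain ⟨n, hn⟩ := Subgroup.nilpotent_iff_lowerCentralSeries.1 ‹Group.IsNilpotent G›
  obtain ⟨k, hk, hx⟩ := h n
  rw [hn, Subgroup.mem_bot] at hx
  exact isOfFinOrder_iff_pow_eq_one.2 ⟨k, hk, hx⟩

theorem isOfFinOrder_mul_of_isNilpotent [Group.IsNilpotent G] {a b : G} (ha : IsOfFinOrder a)
    (hb : IsOfFinOrder b) : IsOfFinOrder (a * b) := by
  have hau : a ∈ Subgroup.closure {a, b} := Subgroup.subset_closure (by simp)
  have hbu : b ∈ Subgroup.closure {a, b} := Subgroup.subset_closure (by simp)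
  have h := isOfFinOrder_of_closure_eq_top (G := Subgroup.closure {a, b})
    (S := ((↑) : Subgroup.closure {a, b} → G) ⁻¹' {a, b})
    Subgroup.closure_closure_coe_preimage
    (by
      rintro ⟨s, hs⟩ hs'
      rw [← (Subgroup.subtype_injective _).isOfFinOrder_iff]
      rcases hs' with h | h
      · change s = a at h
        subst h; exact ha
      · change s = b at h
        subst h; exact hb)
    (⟨a, hau⟩ * ⟨b, hbu⟩)
  rw [← (Subgroup.subtype_injective _).isOfFinOrder_iff] at h
  exact h

instance isNilpotent_quotient_lowerCentralSeries (n : ℕ) :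
    Group.IsNilpotent (G ⧸ (⊤ : Subgroup G).lowerCentralSeries n) := by
  rw [Subgroup.nilpotent_iff_lowerCentralSeries]
  refine ⟨n, ?_⟩
  rw [← Subgroup.map_top_of_surjective (QuotientGroup.mk' ((⊤ : Subgroup G).lowerCentralSeries n))
    (QuotientGroup.mk'_surjective _), ← Subgroup.map_lowerCentralSeries,
    QuotientGroup.map_mk'_self]

variable (G) in
/-- The isolator `{x | ∃ k > 0, x ^ k ∈ γ}` of a term `γ` of the lower central series of `G`.
Terms are numbered from `0`, so that `isolator G 0 = G` and `isolator G 1` is the isolator of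
`[G, G]`. -/
def isolator (n : ℕ) : Subgroup G where
  carrier := {x | ∃ k : ℕ, 0 < k ∧ x ^ k ∈ (⊤ : Subgroup G).lowerCentralSeries n}
  one_mem' := ⟨1, one_pos, by simp⟩
  inv_mem' := by
    rintro x ⟨k, hk, h⟩
    exact ⟨k, hk, by rw [inv_pow]; exact Subgroup.inv_mem _ h⟩
  mul_mem' := by
    have key : ∀ x : G, (∃ k : ℕ, 0 < k ∧ x ^ k ∈ (⊤ : Subgroup G).lowerCentralSeries n) ↔
        IsOfFinOrder (x : G ⧸ (⊤ : Subgroup G).lowerCentralSeries n) := by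
      intro x
      rw [isOfFinOrder_iff_pow_eq_one]
      simp only [← QuotientGroup.mk_pow, QuotientGroup.eq_one_iff]
    intro x y hx hy
    exact (key _).2 (isOfFinOrder_mul_of_isNilpotent ((key x).1 hx) ((key y).1 hy))

theorem mem_isolator {n : ℕ} {x : G} :
    x ∈ isolator G n ↔ ∃ k : ℕ, 0 < k ∧ x ^ k ∈ (⊤ : Subgroup G).lowerCentralSeries n := Iff.rfl

instance isolator_normal (n : ℕ) : (isolator G n).Normal where
  conj_mem := by
    rintro x ⟨k, hk, h⟩ g
    exact ⟨k, hk, by rw [conj_pow]; exact Subgroup.Normal.conj_mem inferInstance _ h g⟩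

theorem isolator_zero : isolator G 0 = ⊤ :=
  eq_top_iff.2 fun _ _ => ⟨1, one_pos, Subgroup.mem_top _⟩

theorem isolator_antitone : Antitone (isolator G) := by
  rintro m n hmn x ⟨k, hk, h⟩
  exact ⟨k, hk, Subgroup.lowerCentralSeries_antitone _ hmn h⟩

theorem mem_isolator_of_pow_mem {n : ℕ} {x : G} {k : ℕ} (hk : 0 < k)
    (h : x ^ k ∈ isolator G n) : x ∈ isolator G n := by
  obtain ⟨l, hl, h⟩ := h
  exact ⟨k * l, Nat.mul_pos hk hl, by rwa [pow_mul]⟩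

theorem mem_upperCentralSeries_of_pow_mem (htf : ∀ x : G, IsOfFinOrder x → x = 1) (i : ℕ) :
    ∀ (x : G) (k : ℕ), 0 < k → x ∈ Subgroup.upperCentralSeries G (i + 1) →
      x ^ k ∈ Subgroup.upperCentralSeries G i → x ∈ Subgroup.upperCentralSeries G i := by
  induction i with
  | zero =>
    intro x k hk _ h
    rw [Subgroup.upperCentralSeries_zero, Subgroup.mem_bot] at h ⊢
    exact htf x (isOfFinOrder_iff_pow_eq_one.2 ⟨k, hk, h⟩)
  | succ i ih =>
    intro x k hk hx h
    have comm : ∀ z ∈ Subgroup.upperCentralSeries G (i + 1), ∀ y : G,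
        Commute (z : G ⧸ Subgroup.upperCentralSeries G i) (y : G ⧸ _) := by
      intro z hz y
      rw [← commutatorElement_eq_one_iff_commute]
      exact (QuotientGroup.eq_one_iff (N := Subgroup.upperCentralSeries G i) ⁅z, y⁆).2
        (Subgroup.mem_upperCentralSeries_succ_iff.1 hz y)
    rw [Subgroup.mem_upperCentralSeries_succ_iff] at hx ⊢
    intro g
    have hg := hx g
    refine ih _ k hk hg ?_
    rw [← QuotientGroup.eq_one_iff]
    exact commutator_pow_eq_one (x := (x : G ⧸ Subgroup.upperCentralSeries G i))
      (g := (g : G ⧸ _)) (comm _ hg x) (comm _ h g)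

theorem mem_center_of_pow_mem_center [Group.IsNilpotent G]
    (htf : ∀ x : G, IsOfFinOrder x → x = 1) {x : G} {k : ℕ} (hk : 0 < k)
    (h : x ^ k ∈ Subgroup.center G) : x ∈ Subgroup.center G := by
  have key : ∀ i : ℕ, x ∈ Subgroup.upperCentralSeries G (i + 1) →
      x ∈ Subgroup.upperCentralSeries G 1 := by
    intro i
    induction i with
    | zero => exact id
    | succ i ih =>
      intro hx
      refine ih (mem_upperCentralSeries_of_pow_mem htf _ x k hk hx ?_)
      rw [← Subgroup.upperCentralSeries_one] at h
      exact Subgroup.upperCentralSeries_mono G (Nat.le_add_left 1 i) h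
  obtain ⟨n, hn⟩ := ‹Group.IsNilpotent G›.nilpotent
  rw [← Subgroup.upperCentralSeries_one]
  refine key n (Subgroup.upperCentralSeries_mono G (Nat.le_succ n) ?_)
  rw [hn]
  exact Subgroup.mem_top x

theorem commutator_mem_isolator_succ {n : ℕ} {x : G} (hx : x ∈ isolator G n) (g : G) :
    ⁅x, g⁆ ∈ isolator G (n + 1) := by
  have hle : (⊤ : Subgroup G).lowerCentralSeries (n + 1) ≤ isolator G (n + 1) :=
    fun y hy => ⟨1, one_pos, by simpa using hy⟩
  have hnil : Group.IsNilpotent (G ⧸ isolator G (n + 1)) := by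
    rw [Subgroup.nilpotent_iff_lowerCentralSeries]
    refine ⟨n + 1, ?_⟩
    rw [← Subgroup.map_top_of_surjective (QuotientGroup.mk' (isolator G (n + 1)))
      (QuotientGroup.mk'_surjective _), ← Subgroup.map_lowerCentralSeries, eq_bot_iff]
    rintro _ ⟨y, hy, rfl⟩
    exact (QuotientGroup.eq_one_iff (N := isolator G (n + 1)) y).2 (hle hy)
  have htf : ∀ y : G ⧸ isolator G (n + 1), IsOfFinOrder y → y = 1 := by
    intro y
    induction y using QuotientGroup.induction_on with
    | H y =>
      intro hy
      obtain ⟨k, hk, h⟩ := isOfFinOrder_iff_pow_eq_one.1 hy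
      rw [← QuotientGroup.mk_pow, QuotientGroup.eq_one_iff] at h
      exact (QuotientGroup.eq_one_iff _).2 (mem_isolator_of_pow_mem hk h)
  obtain ⟨k, hk, h⟩ := hx
  have hc : (x : G ⧸ isolator G (n + 1)) ∈ Subgroup.center _ := by
    refine mem_center_of_pow_mem_center htf hk ?_
    rw [Subgroup.mem_center_iff]
    intro y
    induction y using QuotientGroup.induction_on with
    | H y =>
      refine Eq.symm ?_
      change Commute _ _
      rw [← commutatorElement_eq_one_iff_commute]
      refine (QuotientGroup.eq_one_iff (N := isolator G (n + 1)) ⁅x ^ k, y⁆).2 (hle ?_)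
      exact Subgroup.commutator_mem_commutator h (Subgroup.mem_top y)
  rw [← QuotientGroup.eq_one_iff]
  exact commutatorElement_eq_one_iff_commute.2 (Subgroup.mem_center_iff.1 hc g).symm

variable (G) in
/-- `G` is residually torsion-free nilpotent: it has a descending series of normal subgroups
with torsion-free nilpotent quotients and trivial intersection. -/
def IsResiduallyTorsionFreeNilpotent : Prop :=
  ∃ N : ℕ → Subgroup G, N 0 = ⊤ ∧ Antitone N ∧
    (∀ n, ∃ _ : (N n).Normal, Group.IsNilpotent (G ⧸ N n) ∧
      ∀ x : G ⧸ N n, IsOfFinOrder x → x = 1) ∧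
    ⨅ n, N n = ⊥

theorem IsResiduallyTorsionFreeNilpotent.exists_notMem_isolator
    (hG : IsResiduallyTorsionFreeNilpotent G) {x : G} (hx : x ≠ 1) : ∃ n, x ∉ isolator G n := by
  obtain ⟨N, -, -, hN, hbot⟩ := hG
  by_contra! h
  refine hx ?_
  rw [← Subgroup.mem_bot, ← hbot, Subgroup.mem_iInf]
  intro i
  obtain ⟨_, hnil, htf⟩ := hN i
  obtain ⟨n, hn⟩ := Subgroup.nilpotent_iff_lowerCentralSeries.1 hnil
  obtain ⟨k, hk, hk'⟩ := h n
  rw [← QuotientGroup.eq_one_iff]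
  refine htf _ (isOfFinOrder_iff_pow_eq_one.2 ⟨k, hk, ?_⟩)
  rw [← Subgroup.map_top_of_surjective (QuotientGroup.mk' (N i)) (QuotientGroup.mk'_surjective _),
    ← Subgroup.map_lowerCentralSeries] at hn
  rw [← QuotientGroup.mk_pow, ← Subgroup.mem_bot, ← hn]
  exact ⟨_, hk', rfl⟩

end Isolators

/-! ### Bi-invariant orders -/

/-- A total order on a group that is invariant under left and right multiplication. -/
structure BiOrder (G : Type*) [Group G] extends LinearOrder G where
  mul_le_mul_left_of_le : ∀ a b c : G, a ≤ b → c * a ≤ c * b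
  mul_le_mul_right_of_le : ∀ a b c : G, a ≤ b → a * c ≤ b * c

/-- A subset of a group is well-ordered for the bi-invariant order `o`. -/
def BiOrder.WellOrdered {G : Type*} [Group G] (o : BiOrder G) (s : Set G) : Prop :=
  letI := o.toLinearOrder
  s.IsWF

section IsolatorOrder

open scoped commutatorElement

variable {G : Type*} [Group G]

variable (G) in
/-- The successive quotients of the series of isolators. -/
abbrev IsolatorQuotient (n : ℕ) : Type _ :=
  isolator G n ⧸ (isolator G (n + 1)).subgroupOf (isolator G n)

/-- The positive elements of `G`, for given orders on the successive quotients of the series of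
isolators: `x` is positive if `x` belongs to the `n`-th isolator but not to the next one, and its
class in the `n`-th quotient is positive. -/
def IsolatorPos (P : ∀ n, BiOrder (IsolatorQuotient G n)) (x : G) : Prop :=
  ∃ (n : ℕ) (hx : x ∈ isolator G n), x ∉ isolator G (n + 1) ∧
    (P n).lt 1 (QuotientGroup.mk ⟨x, hx⟩)

theorem isolatorQuotient_mk_eq {n : ℕ} {x y : G} (hx : x ∈ isolator G n) (hy : y ∈ isolator G n)
    (h : x⁻¹ * y ∈ isolator G (n + 1)) :
    (QuotientGroup.mk ⟨x, hx⟩ : IsolatorQuotient G n) = QuotientGroup.mk ⟨y, hy⟩ :=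
  QuotientGroup.eq.2 (Subgroup.mem_subgroupOf.2 h)

theorem isolatorQuotient_mk_eq_one {n : ℕ} {x : G} (hx : x ∈ isolator G n) :
    (QuotientGroup.mk ⟨x, hx⟩ : IsolatorQuotient G n) = 1 ↔ x ∈ isolator G (n + 1) := by
  rw [QuotientGroup.eq_one_iff, Subgroup.mem_subgroupOf]

variable {P : ∀ n, BiOrder (IsolatorQuotient G n)}

theorem isolatorPos_intro {n : ℕ} {x : G} (hx : x ∈ isolator G n)
    (h : (P n).lt 1 (QuotientGroup.mk ⟨x, hx⟩)) : IsolatorPos P x := by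
  refine ⟨n, hx, fun hx' => ?_, h⟩
  rw [(isolatorQuotient_mk_eq_one hx).2 hx'] at h
  let _ := (P n).toLinearOrder
  exact lt_irrefl _ h

theorem not_isolatorPos_one : ¬ IsolatorPos P 1 := by
  rintro ⟨n, -, h, -⟩
  exact h (Subgroup.one_mem _)

theorem IsolatorPos.conj {x : G} (h : IsolatorPos P x) (g : G) : IsolatorPos P (g * x * g⁻¹) := by
  obtain ⟨n, hx, -, h⟩ := h
  have hx' : g * x * g⁻¹ ∈ isolator G n := Subgroup.Normal.conj_mem inferInstance _ hx g
  refine isolatorPos_intro hx' ?_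
  rw [← isolatorQuotient_mk_eq hx hx']
  · exact h
  · have := commutator_mem_isolator_succ (Subgroup.inv_mem _ hx) g
    rw [commutatorElement_def, inv_inv] at this
    simpa [mul_assoc] using this

theorem IsolatorPos.mul {x y : G} (hx : IsolatorPos P x) (hy : IsolatorPos P y) :
    IsolatorPos P (x * y) := by
  obtain ⟨n, hxn, hxn', hx⟩ := hx
  obtain ⟨m, hym, hym', hy⟩ := hy
  rcases lt_trichotomy n m with hnm | rfl | hnm
  · have hy1 : y ∈ isolator G (n + 1) := isolator_antitone hnm hym
    have hyn : y ∈ isolator G n := isolator_antitone hnm.le hym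
    refine isolatorPos_intro (Subgroup.mul_mem _ hxn hyn) ?_
    rw [← isolatorQuotient_mk_eq hxn]
    · exact hx
    · simpa using hy1
  · refine isolatorPos_intro (Subgroup.mul_mem _ hxn hym) ?_
    let _ := (P n).toLinearOrder
    have h1 : (QuotientGroup.mk ⟨x, hxn⟩ : IsolatorQuotient G n) * 1 ≤
        QuotientGroup.mk ⟨x, hxn⟩ * QuotientGroup.mk ⟨y, hym⟩ :=
      (P n).mul_le_mul_left_of_le _ _ _ (le_of_lt hy)
    rw [mul_one] at h1
    exact lt_of_lt_of_le hx h1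
  · have hx1 : x ∈ isolator G (m + 1) := isolator_antitone hnm hxn
    have hxm : x ∈ isolator G m := isolator_antitone hnm.le hxn
    refine isolatorPos_intro (Subgroup.mul_mem _ hxm hym) ?_
    rw [← isolatorQuotient_mk_eq hym]
    · exact hy
    · have := Subgroup.Normal.conj_mem (isolator_normal (G := G) (m + 1)) _ hx1 y⁻¹
      simpa [mul_assoc] using this

theorem isolatorPos_or_inv (hG : IsResiduallyTorsionFreeNilpotent G) {x : G} (hx : x ≠ 1) :
    IsolatorPos P x ∨ IsolatorPos P x⁻¹ := by
  classical
  have hex := hG.exists_notMem_isolator hx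
  obtain ⟨n, hn⟩ : ∃ n, Nat.find hex = n + 1 := by
    refine Nat.exists_eq_succ_of_ne_zero fun h0 => ?_
    have := Nat.find_spec hex
    rw [h0, isolator_zero] at this
    exact this (Subgroup.mem_top x)
  have hxn1 : x ∉ isolator G (n + 1) := hn ▸ Nat.find_spec hex
  have hxn : x ∈ isolator G n := not_not.1 (Nat.find_min hex (m := n) (by omega))
  let _ := (P n).toLinearOrder
  have hne : (QuotientGroup.mk ⟨x, hxn⟩ : IsolatorQuotient G n) ≠ 1 :=
    fun h => hxn1 ((isolatorQuotient_mk_eq_one hxn).1 h)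
  rcases lt_or_gt_of_ne hne with h | h
  · right
    have hinv : x⁻¹ ∈ isolator G n := Subgroup.inv_mem _ hxn
    refine isolatorPos_intro hinv ?_
    have hle := (P n).mul_le_mul_left_of_le _ _ (QuotientGroup.mk ⟨x⁻¹, hinv⟩) (le_of_lt h)
    have he : (QuotientGroup.mk ⟨x⁻¹, hinv⟩ : IsolatorQuotient G n) * QuotientGroup.mk ⟨x, hxn⟩
        = 1 := inv_mul_cancel (QuotientGroup.mk ⟨x, hxn⟩ : IsolatorQuotient G n)
    rw [he, mul_one] at hle
    refine lt_of_le_of_ne hle fun h1 => hne ?_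
    rw [← h1, one_mul] at he
    exact he
  · exact Or.inl (isolatorPos_intro hxn h)

open Classical in
/-- The bi-invariant order on a residually torsion-free nilpotent group `G` determined by orders on
the successive quotients of the series of isolators: `x < y` if and only if `x⁻¹ * y` is
positive. -/
noncomputable def isolatorOrder (hG : IsResiduallyTorsionFreeNilpotent G)
    (P : ∀ n, BiOrder (IsolatorQuotient G n)) : BiOrder G where
  le x y := x = y ∨ IsolatorPos P (x⁻¹ * y)
  lt x y := IsolatorPos P (x⁻¹ * y)
  le_refl x := Or.inl rfl
  le_trans x y z := by
    rintro (rfl | hxy) (rfl | hyz)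
    · exact Or.inl rfl
    · exact Or.inr hyz
    · exact Or.inr hxy
    · right
      have := hxy.mul hyz
      simpa [mul_assoc] using this
  lt_iff_le_not_ge x y := by
    constructor
    · intro h
      refine ⟨Or.inr h, ?_⟩
      rintro (rfl | h')
      · rw [inv_mul_cancel] at h
        exact not_isolatorPos_one h
      · have := h.mul h'
        refine not_isolatorPos_one (P := P) ?_
        simpa [mul_assoc] using this
    · rintro ⟨rfl | h, h'⟩
      · exact absurd (Or.inl rfl) h'
      · exact h
  le_antisymm x y := by
    rintro (rfl | hxy) (h | hyx)
    · rfl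
    · rfl
    · exact h.symm
    · have := hxy.mul hyx
      refine absurd ?_ (not_isolatorPos_one (P := P))
      simpa [mul_assoc] using this
  le_total x y := by
    by_cases h : x = y
    · exact Or.inl (Or.inl h)
    · rcases isolatorPos_or_inv (P := P) hG (x := x⁻¹ * y)
        (fun h1 => h (inv_mul_eq_one.1 h1)) with h1 | h1
      · exact Or.inl (Or.inr h1)
      · exact Or.inr (Or.inr (by simpa using h1))
  toDecidableLE := Classical.decRel _
  mul_le_mul_left_of_le a b c := by
    rintro (rfl | h)
    · exact Or.inl rfl
    · exact Or.inr (by simpa [mul_assoc] using h)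
  mul_le_mul_right_of_le a b c := by
    rintro (rfl | h)
    · exact Or.inl rfl
    · exact Or.inr (by simpa [mul_assoc] using h.conj c⁻¹)

end IsolatorOrder

/-! ### The Mal'cev–Neumann completion -/

section WellOrdered

open scoped Pointwise

variable {G : Type*} [Group G] (o : BiOrder G)

theorem BiOrder.WellOrdered.mono {o : BiOrder G} {s t : Set G} (ht : o.WellOrdered t)
    (h : s ⊆ t) : o.WellOrdered s := by
  let _ := o.toLinearOrder
  exact Set.IsWF.mono ht h

theorem BiOrder.WellOrdered.union {o : BiOrder G} {s t : Set G} (hs : o.WellOrdered s)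
    (ht : o.WellOrdered t) : o.WellOrdered (s ∪ t) := by
  let _ := o.toLinearOrder
  exact Set.IsWF.union hs ht

theorem BiOrder.wellOrdered_of_finite {s : Set G} (hs : s.Finite) : o.WellOrdered s := by
  let _ := o.toLinearOrder
  exact hs.isWF

theorem BiOrder.WellOrdered.mul {o : BiOrder G} {s t : Set G} (hs : o.WellOrdered s)
    (ht : o.WellOrdered t) : o.WellOrdered (s * t) := by
  let _ := o.toLinearOrder
  have hs' : s.IsPWO := Set.IsWF.isPWO hs
  have ht' : t.IsPWO := Set.IsWF.isPWO ht
  have h : (s * t).IsPWO := by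
    rw [← Set.image_mul_prod]
    refine (hs'.prod ht').image_of_monotone ?_
    rintro ⟨a, b⟩ ⟨c, d⟩ ⟨h1, h2⟩
    exact le_trans (o.mul_le_mul_right_of_le a c b h1) (o.mul_le_mul_left_of_le b d c h2)
  exact h.isWF

theorem BiOrder.WellOrdered.finite_setOf_mem {o : BiOrder G} {s t : Set G} (hs : o.WellOrdered s)
    (ht : o.WellOrdered t) (g : G) : {a | a ∈ s ∧ a⁻¹ * g ∈ t}.Finite := by
  let _ := o.toLinearOrder
  have : MulLeftMono G := ⟨fun c a b h => o.mul_le_mul_left_of_le a b c h⟩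
  have : MulRightMono G := ⟨fun c a b h => o.mul_le_mul_right_of_le a b c h⟩
  have hs' : s.IsPWO := Set.IsWF.isPWO hs
  by_contra hinf
  have hinf : {a | a ∈ s ∧ a⁻¹ * g ∈ t}.Infinite := hinf
  obtain ⟨φ, hφ⟩ := hs'.exists_monotone_subseq (f := fun n => (hinf.natEmbedding _ n : G))
    (fun n => (hinf.natEmbedding _ n).2.1)
  have ht' : t.IsPWO := Set.IsWF.isPWO ht
  obtain ⟨m, n, hmn, hle⟩ := ht' fun n => ⟨_, (hinf.natEmbedding _ (φ n)).2.2⟩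
  have h1 : (hinf.natEmbedding _ (φ m) : G) ≤ hinf.natEmbedding _ (φ n) := hφ hmn.le
  have h2 : (hinf.natEmbedding _ (φ n) : G) ≤ hinf.natEmbedding _ (φ m) := by
    have hle' := (mul_le_mul_iff_right g).1 hle
    exact inv_le_inv_iff.1 hle'
  have h3 := (hinf.natEmbedding _).injective (Subtype.ext (le_antisymm h1 h2))
  exact hmn.ne (φ.injective h3)

end WellOrdered

/-- The Mal'cev–Neumann completion `K⟨G⟩`: formal series on `G` with coefficients in `K` whose
support is well-ordered for the bi-invariant order `o` on `G`. -/
@[ext]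
structure MalcevNeumann (K : Type*) [DivisionRing K] {G : Type*} [Group G] (o : BiOrder G) where
  /-- The coefficients of a series. -/
  coeff : G → K
  wellOrdered_support : o.WellOrdered (Function.support coeff)

namespace MalcevNeumann

open scoped Pointwise

variable {K : Type*} [DivisionRing K] {G : Type*} [Group G] {o : BiOrder G}

theorem finite_support_mul (x y : MalcevNeumann K o) (g : G) :
    (Function.support fun a => x.coeff a * y.coeff (a⁻¹ * g)).Finite :=
  (x.wellOrdered_support.finite_setOf_mem y.wellOrdered_support g).subset fun _ ha =>
    ⟨left_ne_zero_of_mul ha, right_ne_zero_of_mul ha⟩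

theorem support_mul_subset (x y : MalcevNeumann K o) :
    (Function.support fun g => ∑ᶠ a, x.coeff a * y.coeff (a⁻¹ * g)) ⊆
      Function.support x.coeff * Function.support y.coeff := by
  intro g hg
  obtain ⟨a, ha⟩ : ∃ a, x.coeff a * y.coeff (a⁻¹ * g) ≠ 0 := by
    by_contra! h
    exact hg (finsum_eq_zero_of_forall_eq_zero h)
  exact ⟨a, left_ne_zero_of_mul ha, _, right_ne_zero_of_mul ha, mul_inv_cancel_left a g⟩

instance : Zero (MalcevNeumann K o) :=
  ⟨⟨fun _ => 0, o.wellOrdered_of_finite (by simp)⟩⟩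

open Classical in
noncomputable instance : One (MalcevNeumann K o) :=
  ⟨⟨fun g => if g = 1 then 1 else 0, o.wellOrdered_of_finite
    ((Set.finite_singleton (1 : G)).subset fun g hg => by
      by_contra h
      exact hg (if_neg h))⟩⟩

instance : Add (MalcevNeumann K o) :=
  ⟨fun x y => ⟨fun g => x.coeff g + y.coeff g,
    (x.wellOrdered_support.union y.wellOrdered_support).mono (Function.support_add _ _)⟩⟩

instance : Neg (MalcevNeumann K o) :=
  ⟨fun x => ⟨fun g => - x.coeff g, x.wellOrdered_support.mono fun _ hg => neg_ne_zero.1 hg⟩⟩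

/-- The convolution product: the coefficient of `g` is the sum of `x a * y b` over the (finitely
many) pairs `(a, b)` of elements of the supports with `a * b = g`. -/
noncomputable instance : Mul (MalcevNeumann K o) :=
  ⟨fun x y => ⟨fun g => ∑ᶠ a, x.coeff a * y.coeff (a⁻¹ * g),
    (x.wellOrdered_support.mul y.wellOrdered_support).mono (support_mul_subset x y)⟩⟩

theorem coeff_zero (g : G) : (0 : MalcevNeumann K o).coeff g = 0 := rfl

theorem coeff_add (x y : MalcevNeumann K o) (g : G) :
    (x + y).coeff g = x.coeff g + y.coeff g := rfl

theorem coeff_neg (x : MalcevNeumann K o) (g : G) : (-x).coeff g = - x.coeff g := rfl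

theorem coeff_mul (x y : MalcevNeumann K o) (g : G) :
    (x * y).coeff g = ∑ᶠ a, x.coeff a * y.coeff (a⁻¹ * g) := rfl

theorem coeff_one_one : (1 : MalcevNeumann K o).coeff 1 = 1 := if_pos rfl

theorem coeff_one_of_ne {g : G} (h : g ≠ 1) : (1 : MalcevNeumann K o).coeff g = 0 := if_neg h

protected theorem mul_assoc (x y z : MalcevNeumann K o) : x * y * z = x * (y * z) := by
  ext g
  have hfin : (Function.support fun p : G × G =>
      x.coeff p.1 * y.coeff (p.1⁻¹ * p.2) * z.coeff (p.2⁻¹ * g)).Finite := by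
    have h1 := (x.wellOrdered_support.mul y.wellOrdered_support).finite_setOf_mem
      z.wellOrdered_support g
    refine (h1.biUnion fun c _ => (x.wellOrdered_support.finite_setOf_mem
      y.wellOrdered_support c).image fun a => (a, c)).subset ?_
    rintro ⟨a, c⟩ h
    have hz := right_ne_zero_of_mul h
    have hxy := left_ne_zero_of_mul h
    have hx := left_ne_zero_of_mul hxy
    have hy := right_ne_zero_of_mul hxy
    refine Set.mem_biUnion (x := c) ⟨⟨a, hx, _, hy, mul_inv_cancel_left a c⟩, hz⟩ ?_
    exact ⟨a, ⟨hx, hy⟩, rfl⟩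
  have hfin' : (Function.support fun p : G × G =>
      x.coeff p.2 * y.coeff (p.2⁻¹ * p.1) * z.coeff (p.1⁻¹ * g)).Finite :=
    (hfin.image Prod.swap).subset fun p hp => ⟨p.swap, hp, Prod.swap_swap p⟩
  calc (x * y * z).coeff g
      = ∑ᶠ c, ∑ᶠ a, x.coeff a * y.coeff (a⁻¹ * c) * z.coeff (c⁻¹ * g) := by
        rw [coeff_mul]
        refine finsum_congr fun c => ?_
        rw [coeff_mul, finsum_mul]
    _ = ∑ᶠ p : G × G, x.coeff p.2 * y.coeff (p.2⁻¹ * p.1) * z.coeff (p.1⁻¹ * g) :=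
        (finsum_curry _ hfin').symm
    _ = ∑ᶠ p : G × G, x.coeff p.1 * y.coeff (p.1⁻¹ * p.2) * z.coeff (p.2⁻¹ * g) :=
        finsum_eq_of_bijective Prod.swap Prod.swap_bijective fun _ => rfl
    _ = ∑ᶠ a, ∑ᶠ c, x.coeff a * y.coeff (a⁻¹ * c) * z.coeff (c⁻¹ * g) := finsum_curry _ hfin
    _ = (x * (y * z)).coeff g := by
        rw [coeff_mul]
        refine finsum_congr fun a => ?_
        rw [coeff_mul, mul_finsum]
        refine finsum_eq_of_bijective (fun c => a⁻¹ * c) (Group.mulLeft_bijective a⁻¹) fun c => ?_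
        simp [mul_assoc]

noncomputable instance : Ring (MalcevNeumann K o) where
  add_assoc x y z := by ext g; exact add_assoc _ _ _
  zero_add x := by ext g; exact zero_add _
  add_zero x := by ext g; exact add_zero _
  add_comm x y := by ext g; exact add_comm _ _
  neg_add_cancel x := by ext g; exact neg_add_cancel _
  nsmul := nsmulRec
  zsmul := zsmulRec
  left_distrib x y z := by
    ext g
    simp only [coeff_mul, coeff_add, mul_add]
    exact finsum_add_distrib (finite_support_mul x y g) (finite_support_mul x z g)
  right_distrib x y z := by
    ext g
    simp only [coeff_mul, coeff_add, add_mul]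
    exact finsum_add_distrib (finite_support_mul x z g) (finite_support_mul y z g)
  zero_mul x := by
    ext g
    simp [coeff_mul, coeff_zero]
  mul_zero x := by
    ext g
    simp [coeff_mul, coeff_zero]
  mul_assoc := MalcevNeumann.mul_assoc
  one_mul x := by
    ext g
    rw [coeff_mul, finsum_eq_single _ 1 fun a ha => by rw [coeff_one_of_ne ha, zero_mul]]
    simp [coeff_one_one]
  mul_one x := by
    ext g
    rw [coeff_mul, finsum_eq_single _ g fun a ha => by
      rw [coeff_one_of_ne (fun h => ha (inv_mul_eq_one.1 h)), mul_zero]]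
    simp [coeff_one_one]

end MalcevNeumann

/-! ### Series with controlled support -/

/-- For a subgroup `N` of `G`, the set `K[N]⟨G/N⟩` of formal series `∑ t ∈ T, c t * t` on `G`, where
`T` is a well-ordered subset of a transversal `R` of `N` in `G` and every `c t` belongs to the
group algebra `K[N]`: the coefficient of `h * t` is that of `h` in `c t` if `t ∈ T` and `h ∈ N`,
and the coefficients of the elements outside `N * T` vanish. -/
def controlledSeries (K : Type*) [DivisionRing K] {G : Type*} [Group G] (o : BiOrder G)
    (N : Subgroup G) : Set (G → K) :=
  {f | ∃ (R T : Set G) (c : G → MonoidAlgebra K N),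
    Subgroup.IsComplement (N : Set G) R ∧ T ⊆ R ∧ o.WellOrdered T ∧
    (∀ t ∈ T, ∀ h : N, f (h * t) = (c t).coeff h) ∧
    ∀ g : G, (∀ t ∈ T, ∀ h : N, g ≠ h * t) → f g = 0}

/-- The set `S(G)`: the union of the sets `ℚ[Gₙ]⟨G/Gₙ⟩`, where `Gₙ` runs over the isolators of the
terms of the lower central series, starting from `G` itself. -/
def eizenbudLichtman {G : Type*} [Group G] (o : BiOrder G) : Set (G → ℚ) :=
  ⋃ n : ℕ, controlledSeries ℚ o (isolator G n)

/-!
For a convex normal subgroup `N`, compare two elements of `G` by the order of their cosets and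
declare distinct elements of the same coset incomparable. This is a partial order compatible with
the multiplication, and `K[N]⟨G/N⟩` consists of the series whose support is partially well-ordered
for it; such supports are closed under products, so these series form a ring.

A series with a least term `c * g` for this order is `c * g` times a series `1 - z` with the support
of `z` above `1`, and `y = 1 + y * z` is solved recursively on the submonoid generated by the
support of `z`, which is partially well-ordered by Higman's lemma. The leading coset of a nonzero
series contains only finitely many terms, which are separated by a smaller subgroup of the family:
modulo that subgroup the series has a least term.
-/

section PartiallyWellOrdered

open scoped Pointwise

variable {α β : Type*}

theorem isPWO_mul [Mul α] [Preorder α] [MulLeftMono α] [MulRightMono α] {s t : Set α}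
    (hs : s.IsPWO) (ht : t.IsPWO) : (s * t).IsPWO := by
  rw [← image_mul_prod]
  exact (hs.prod ht).image_of_monotone (monotone_fst.mul' monotone_snd)

theorem isPWO_submonoidClosure [Monoid α] [Preorder α] [MulLeftMono α] [MulRightMono α]
    {s : Set α} (hs : s.IsPWO) (hone_le : ∀ a ∈ s, 1 ≤ a) :
    (Submonoid.closure s : Set α).IsPWO := by
  rw [Submonoid.closure_eq_image_prod]
  exact (hs.partiallyWellOrderedOn_sublistForall₂ (· ≤ ·)).image_of_monotone_on
    fun _ _ _ hl h => h.prod_le_prod' fun a ha => hone_le a (hl a ha)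

theorem partiallyWellOrderedOn_of_finite_fibers [PartialOrder β] {r : α → α → Prop} [Std.Refl r]
    {s : Set α} {π : α → β} (himage : (π '' s).IsPWO)
    (hfiber : ∀ b, {a ∈ s | π a = b}.Finite)
    (hlt : ∀ a₁ ∈ s, ∀ a₂ ∈ s, π a₁ < π a₂ → r a₁ a₂) : s.PartiallyWellOrderedOn r := by
  refine partiallyWellOrderedOn_iff_exists_lt.2 fun u hu => ?_
  obtain ⟨φ, hφ⟩ := himage.exists_monotone_subseq fun n => mem_image_of_mem π (hu n)
  by_cases hjump : ∃ i, π (u (φ 0)) < π (u (φ i))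
  · obtain ⟨i, hi⟩ := hjump
    have hi0 : 0 < i := Nat.pos_of_ne_zero (by rintro rfl; exact hi.false)
    exact ⟨φ 0, φ i, φ.strictMono hi0, hlt _ (hu _) _ (hu _) hi⟩
  · have hconst (i : ℕ) : π (u (φ i)) = π (u (φ 0)) :=
      ((hφ i.zero_le).eq_of_not_lt fun h => hjump ⟨i, h⟩).symm
    obtain ⟨i, j, hij, h⟩ := ((hfiber (π (u (φ 0)))).partiallyWellOrderedOn (r := r)).exists_lt
      fun i => ⟨hu (φ i), hconst i⟩
    exact ⟨φ i, φ j, φ.strictMono hij, h⟩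

end PartiallyWellOrdered

namespace BiOrder

variable {G : Type*} [Group G] {o : BiOrder G} {N M : Subgroup G}

protected theorem lt_of_le_of_ne {a b : G} (hle : o.le a b) (hne : a ≠ b) : o.lt a b :=
  let _ := o.toLinearOrder
  lt_of_le_of_ne (α := G) hle hne

theorem wellOrdered_of_partiallyWellOrderedOn_le {s : Set G}
    (hs : s.PartiallyWellOrderedOn o.le) : o.WellOrdered s :=
  let _ := o.toLinearOrder
  IsPWO.isWF hs

theorem mul_lt_mul_left_of_lt {a b : G} (h : o.lt a b) (c : G) : o.lt (c * a) (c * b) := by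
  let _ := o.toLinearOrder
  have hab : a < b := h
  exact o.lt_of_le_of_ne (o.mul_le_mul_left_of_le a b c hab.le) ((mul_right_injective c).ne hab.ne)

theorem mul_lt_mul_right_of_lt {a b : G} (h : o.lt a b) (c : G) : o.lt (a * c) (b * c) := by
  let _ := o.toLinearOrder
  have hab : a < b := h
  exact o.lt_of_le_of_ne (o.mul_le_mul_right_of_le a b c hab.le) ((mul_left_injective c).ne hab.ne)

/-- A subgroup is convex if it contains every element lying between two of its elements. -/
def IsConvex (o : BiOrder G) (N : Subgroup G) : Prop :=
  letI := o.toLinearOrder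
  (N : Set G).OrdConnected

theorem IsConvex.lt_mul_of_lt (hN : o.IsConvex N) {x y n : G} (hxy : o.lt x y)
    (hmem : y * x⁻¹ ∉ N) (hn : n ∈ N) : o.lt x (n * y) := by
  let _ := o.toLinearOrder
  refine lt_of_not_ge (α := G) fun hle => hmem ?_
  have hone : 1 ≤ y * x⁻¹ := by
    simpa using o.mul_le_mul_right_of_le x y x⁻¹ (le_of_lt (α := G) hxy)
  have hinv : y * x⁻¹ ≤ n⁻¹ := by
    simpa [mul_assoc] using
      o.mul_le_mul_right_of_le _ _ x⁻¹ (o.mul_le_mul_left_of_le _ _ n⁻¹ hle)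
  exact OrdConnected.out hN N.one_mem (N.inv_mem hn) ⟨hone, hinv⟩

theorem IsConvex.le_total (hN : o.IsConvex N) (hM : o.IsConvex M) : N ≤ M ∨ M ≤ N := by
  let _ := o.toLinearOrder
  refine or_iff_not_imp_left.2 fun hNM y hy => ?_
  obtain ⟨x, hxN, hxM, hx⟩ : ∃ x ∈ N, x ∉ M ∧ o.lt 1 x := by
    obtain ⟨x, hxN, hxM⟩ := SetLike.not_le_iff_exists.1 hNM
    rcases lt_trichotomy x 1 with hx | rfl | hx
    · refine ⟨x⁻¹, N.inv_mem hxN, fun h => hxM (inv_mem_iff.1 h), ?_⟩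
      simpa using o.mul_lt_mul_right_of_lt hx x⁻¹
    · exact absurd M.one_mem hxM
    · exact ⟨x, hxN, hxM, hx⟩
  have hM_lt {m : G} (hm : m ∈ M) : o.lt 1 (m * x) := hM.lt_mul_of_lt hx (by simpa using hxM) hm
  have hlower : x⁻¹ < y := by
    simpa using o.mul_lt_mul_right_of_lt (hM_lt hy) x⁻¹
  have hupper : y < x := by
    simpa using o.mul_lt_mul_left_of_lt (hM_lt (M.inv_mem hy)) y
  exact OrdConnected.out hN (N.inv_mem hxN) hxN ⟨hlower.le, hupper.le⟩

/-- The partial order on `G` in which `x` is less than `y` if it is less than every element of the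
coset `N * y`. If `N` is convex, this compares distinct cosets as `o` does, while distinct elements
of the same coset are incomparable. -/
@[reducible]
def orderMod (o : BiOrder G) (N : Subgroup G) : PartialOrder G where
  le x y := x = y ∨ ∀ n ∈ N, o.lt x (n * y)
  lt x y := ∀ n ∈ N, o.lt x (n * y)
  le_refl _ := Or.inl rfl
  le_trans x y z := by
    let _ := o.toLinearOrder
    rintro (rfl | hxy) (rfl | hyz)
    · exact Or.inl rfl
    · exact Or.inr hyz
    · exact Or.inr hxy
    · have hlt : o.lt x y := by simpa using hxy 1 N.one_mem
      exact Or.inr fun n hn => lt_trans (α := G) hlt (hyz n hn)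
  lt_iff_le_not_ge x y := by
    let _ := o.toLinearOrder
    refine ⟨fun hxy => ⟨Or.inr hxy, ?_⟩, ?_⟩
    · have hlt : o.lt x y := by simpa using hxy 1 N.one_mem
      rintro (rfl | hyx)
      · exact lt_irrefl (α := G) _ hlt
      · exact lt_asymm (α := G) hlt (by simpa using hyx 1 N.one_mem)
    · rintro ⟨rfl | hxy, hyx⟩
      · exact absurd (Or.inl rfl) hyx
      · exact hxy
  le_antisymm x y := by
    let _ := o.toLinearOrder
    rintro (rfl | hxy) (h | hyx)
    · rfl
    · rfl
    · exact h.symm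
    · exact absurd (show o.lt y x by simpa using hyx 1 N.one_mem)
        (lt_asymm (α := G) (show o.lt x y by simpa using hxy 1 N.one_mem))

theorem le_of_orderMod_le {x y : G} (h : (o.orderMod N).le x y) : o.le x y := by
  let _ := o.toLinearOrder
  rcases h with rfl | h
  · exact le_refl x
  · exact le_of_lt (α := G) (by simpa using h 1 N.one_mem)

theorem orderMod_le_of_le (hMN : M ≤ N) {x y : G} (h : (o.orderMod N).le x y) :
    (o.orderMod M).le x y :=
  h.imp_right fun h m hm => h m (hMN hm)

theorem IsConvex.orderMod_lt (hN : o.IsConvex N) {x y : G} (hxy : o.lt x y)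
    (hmem : y * x⁻¹ ∉ N) : (o.orderMod N).lt x y :=
  fun _ hn => hN.lt_mul_of_lt hxy hmem hn

theorem orderMod_lt_mul_mul {x y m n : G} (h : (o.orderMod N).lt x y) (hm : m ∈ N) (hn : n ∈ N) :
    (o.orderMod N).lt (m * x) (n * y) := fun k hk => by
  simpa [mul_assoc] using
    o.mul_lt_mul_left_of_lt (h (m⁻¹ * (k * n)) (N.mul_mem (N.inv_mem hm) (N.mul_mem hk hn))) m

theorem orderMod_lt_of_mul_inv_mem {x y x' y' : G} (h : (o.orderMod N).lt x y)
    (hx : x' * x⁻¹ ∈ N) (hy : y' * y⁻¹ ∈ N) : (o.orderMod N).lt x' y' := by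
  simpa using orderMod_lt_mul_mul h hx hy

theorem orderMod_mulRightMono (o : BiOrder G) (N : Subgroup G) :
    letI := o.orderMod N
    MulRightMono G :=
  letI := o.orderMod N
  ⟨fun c x y => Or.imp (congrArg (· * c)) fun h n hn => by
    simpa [mul_assoc] using o.mul_lt_mul_right_of_lt (h n hn) c⟩

theorem orderMod_mulLeftMono (o : BiOrder G) (N : Subgroup G) [hN : N.Normal] :
    letI := o.orderMod N
    MulLeftMono G :=
  letI := o.orderMod N
  ⟨fun c x y => Or.imp (congrArg (c * ·)) fun h n hn => by
    simpa [mul_assoc] using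
      o.mul_lt_mul_left_of_lt (h (c⁻¹ * n * c) (by simpa using hN.conj_mem n hn c⁻¹)) c⟩

theorem wellOrdered_of_isPWO [PartialOrder G] (hle : ∀ a b : G, a ≤ b → o.le a b) {s : Set G}
    (hs : s.IsPWO) : o.WellOrdered s := by
  have hpwo : s.PartiallyWellOrderedOn o.le := by
    simpa only [image_id] using hs.image_of_monotone_on (f := id) fun a _ b _ => hle a b
  exact wellOrdered_of_partiallyWellOrderedOn_le hpwo

theorem finite_coset_of_partiallyWellOrderedOn_orderMod {s : Set G}
    (hs : s.PartiallyWellOrderedOn (o.orderMod N).le) (g : G) : {x ∈ s | x * g⁻¹ ∈ N}.Finite := by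
  let _ := o.toLinearOrder
  refine IsAntichain.finite_of_partiallyWellOrderedOn (r := (o.orderMod N).le) ?_
    (hs.mono fun x hx => hx.1)
  rintro x ⟨-, hx⟩ y ⟨-, hy⟩ hxy (h | h)
  · exact hxy h
  · have hmem : x * y⁻¹ ∈ N := by
      simpa [mul_assoc] using N.mul_mem hx (N.inv_mem hy)
    exact lt_irrefl (α := G) x (by simpa using h _ hmem)

end BiOrder

section ControlledSeries

variable {K : Type*} [DivisionRing K] {G : Type*} [Group G] {o : BiOrder G} {N : Subgroup G}
  {R T : Set G}

theorem eq_of_mem_isComplement_of_mul_inv_mem (hR : Subgroup.IsComplement (N : Set G) R) {s t : G}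
    (hs : s ∈ R) (ht : t ∈ R) (h : t * s⁻¹ ∈ N) : s = t :=
  congrArg Subtype.val <| (Subgroup.isComplement_iff_existsUnique_mul_inv_mem.1 hR t).unique
    (y₁ := ⟨s, hs⟩) (y₂ := ⟨t, ht⟩) h (by simp)

theorem toRightFun_mul_of_mem (hR : Subgroup.IsComplement (N : Set G) R) (h : N) {t : G}
    (ht : t ∈ R) : (hR.toRightFun (h * t) : G) = t := by
  refine (eq_of_mem_isComplement_of_mul_inv_mem hR ht (hR.toRightFun (h * t)).2 ?_).symm
  simpa [mul_assoc] using N.mul_mem (hR.toRightFun_mul_inv_mem (h * t)) h.2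

theorem partiallyWellOrderedOn_support_of_mem_controlledSeries (hN : o.IsConvex N) {f : G → K}
    (hf : f ∈ controlledSeries K o N) :
    (Function.support f).PartiallyWellOrderedOn (o.orderMod N).le := by
  obtain ⟨R, T, c, hR, hTR, hT, hc, hzero⟩ := hf
  have hsupport {g : G} (hg : g ∈ Function.support f) :
      ∃ h : N, g = h * hR.toRightFun g ∧ (hR.toRightFun g : G) ∈ T := by
    obtain ⟨t, ht, h, rfl⟩ : ∃ t ∈ T, ∃ h : N, g = h * t := by
      by_contra! hne
      exact hg (hzero g hne)
    rw [toRightFun_mul_of_mem hR h (hTR ht)]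
    exact ⟨h, rfl, ht⟩
  have hfiber (t : G) : {g ∈ Function.support f | (hR.toRightFun g : G) = t}.Finite := by
    refine ((c t).coeff.support.finite_toSet.image fun h : N => (h : G) * t).subset ?_
    rintro g ⟨hg, rfl⟩
    obtain ⟨h, hgh, hgT⟩ := hsupport hg
    refine ⟨h, ?_, hgh.symm⟩
    rw [Finset.mem_coe, Finsupp.mem_support_iff, ← hc _ hgT, ← hgh]
    exact hg
  let _ := o.toLinearOrder
  have hrefl : Std.Refl (o.orderMod N).le := ⟨(o.orderMod N).le_refl⟩
  have hTpwo : T.IsPWO := IsWF.isPWO hT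
  refine partiallyWellOrderedOn_of_finite_fibers (π := fun g => (hR.toRightFun g : G))
    (hTpwo.mono ?_) hfiber fun x _ y _ hxy => Or.inr ?_
  · rintro _ ⟨g, hg, rfl⟩
    exact (hsupport hg).choose_spec.2
  · refine BiOrder.orderMod_lt_of_mul_inv_mem (hN.orderMod_lt hxy fun hmem => hxy.ne ?_)
      (hR.mul_inv_toRightFun_mem x) (hR.mul_inv_toRightFun_mem y)
    exact eq_of_mem_isComplement_of_mul_inv_mem hR (hR.toRightFun x).2 (hR.toRightFun y).2 hmem

theorem mem_controlledSeries_of_partiallyWellOrderedOn_support {f : G → K}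
    (hf : (Function.support f).PartiallyWellOrderedOn (o.orderMod N).le) :
    f ∈ controlledSeries K o N := by
  obtain ⟨R, hR, -⟩ := N.exists_isComplement_right 1
  have hfin (t : G) : (Function.support fun h : N => f (h * t)).Finite :=
    ((BiOrder.finite_coset_of_partiallyWellOrderedOn_orderMod hf t).preimage
      ((mul_left_injective t).comp Subtype.val_injective).injOn).subset
      fun h hh => ⟨hh, by simp⟩
  refine ⟨R, (fun g => (hR.toRightFun g : G)) '' Function.support f,
    fun t => .ofCoeff (Finsupp.ofSupportFinite _ (hfin t)), hR, ?_, ?_, fun _ _ _ => rfl, ?_⟩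
  · rintro _ ⟨g, -, rfl⟩
    exact (hR.toRightFun g).2
  · let _ := o.orderMod N
    refine BiOrder.wellOrdered_of_isPWO (fun _ _ => BiOrder.le_of_orderMod_le)
      (hf.image_of_monotone_on ?_)
    rintro x - y - (rfl | h)
    · exact le_rfl
    · exact le_of_lt (BiOrder.orderMod_lt_of_mul_inv_mem h (hR.toRightFun_mul_inv_mem x)
        (hR.toRightFun_mul_inv_mem y))
  · intro g hg
    by_contra hne
    exact hg _ ⟨g, hne, rfl⟩ ⟨_, hR.mul_inv_toRightFun_mem g⟩ (by simp)

end ControlledSeries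

namespace MalcevNeumann

open scoped Pointwise

variable {K : Type*} [DivisionRing K] {G : Type*} [Group G] {o : BiOrder G}

theorem coeff_sub (x y : MalcevNeumann K o) (g : G) :
    (x - y).coeff g = x.coeff g - y.coeff g := by
  rw [sub_eq_add_neg, coeff_add, coeff_neg, sub_eq_add_neg]

theorem support_one_subset : Function.support (1 : MalcevNeumann K o).coeff ⊆ {1} :=
  fun _ hg => by_contra fun h => hg (coeff_one_of_ne h)

instance : Nontrivial (MalcevNeumann K o) :=
  ⟨1, 0, fun h => one_ne_zero (coeff_one_one (K := K) (o := o) ▸ congrArg (coeff · 1) h)⟩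

theorem exists_isLeast_support {x : MalcevNeumann K o} (hx : x ≠ 0) :
    ∃ g ∈ Function.support x.coeff, ∀ h ∈ Function.support x.coeff, o.le g h := by
  let _ := o.toLinearOrder
  have hne : (Function.support x.coeff).Nonempty :=
    Function.support_nonempty_iff.2 fun h => hx (MalcevNeumann.ext h)
  have hwf : (Function.support x.coeff).IsWF := x.wellOrdered_support
  exact ⟨hwf.min hne, hwf.min_mem hne, fun h hh => hwf.min_le hne hh⟩

open Classical in
/-- The series `c * g` with at most one term. -/
noncomputable def single (o : BiOrder G) (g : G) (c : K) : MalcevNeumann K o where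
  coeff := Pi.single g c
  wellOrdered_support :=
    o.wellOrdered_of_finite ((finite_singleton g).subset Pi.support_single_subset)

theorem support_single_subset (g : G) (c : K) : Function.support (single o g c).coeff ⊆ {g} := by
  classical exact Pi.support_single_subset (i := g) (a := c)

theorem coeff_single_mul (g : G) (c : K) (x : MalcevNeumann K o) (h : G) :
    (single o g c * x).coeff h = c * x.coeff (g⁻¹ * h) := by
  rw [coeff_mul, finsum_eq_single _ g fun a ha => by
    rw [Function.notMem_support.1 fun h => ha (support_single_subset g c h), zero_mul]]
  simp [single]

theorem exists_coeff_eq_one_add_finsum {C : Set G} (hC : o.WellOrdered C)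
    {x : MalcevNeumann K o} (hpos : ∀ g ∈ Function.support x.coeff, o.lt 1 g) :
    ∃ c : G → K, Function.support c ⊆ C ∧
      ∀ g ∈ C, c g = (1 : MalcevNeumann K o).coeff g + ∑ᶠ a, c a * x.coeff (a⁻¹ * g) := by
  classical
  let _ := o.toLinearOrder
  have hwf : WellFounded fun a b : G => a < b ∧ a ∈ C ∧ b ∈ C := wellFoundedOn_iff.1 hC
  let c : G → K := hwf.fix fun g ih =>
    if g ∈ C then (1 : MalcevNeumann K o).coeff g +
      ∑ᶠ a, (if h : a < g ∧ a ∈ C ∧ g ∈ C then ih a h else 0) * x.coeff (a⁻¹ * g)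
    else 0
  have hc (g : G) : c g = if g ∈ C then (1 : MalcevNeumann K o).coeff g +
      ∑ᶠ a, (if a < g ∧ a ∈ C ∧ g ∈ C then c a else 0) * x.coeff (a⁻¹ * g) else 0 :=
    hwf.fix_eq _ g
  have hc_zero {g : G} (hg : g ∉ C) : c g = 0 := by rw [hc, if_neg hg]
  refine ⟨c, fun g hg => by_contra fun h => hg (hc_zero h), fun g hg => ?_⟩
  rw [hc, if_pos hg]
  congr 1
  refine finsum_congr fun a => ?_
  by_cases ha : a ∈ C
  · by_cases hx : x.coeff (a⁻¹ * g) = 0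
    · rw [hx, mul_zero, mul_zero]
    · have hlt : a < g := by simpa using o.mul_lt_mul_left_of_lt (hpos _ hx) a
      rw [if_pos ⟨hlt, ha, hg⟩]
  · rw [if_neg fun h => ha h.2.1, hc_zero ha]

theorem exists_mul_one_sub_eq_one {C : Submonoid G} (hC : o.WellOrdered C)
    {x : MalcevNeumann K o} (hxC : Function.support x.coeff ⊆ C)
    (hpos : ∀ g ∈ Function.support x.coeff, o.lt 1 g) :
    ∃ y : MalcevNeumann K o, Function.support y.coeff ⊆ C ∧ y * (1 - x) = 1 := by
  obtain ⟨c, hcC, hc⟩ := exists_coeff_eq_one_add_finsum hC hpos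
  let y : MalcevNeumann K o := ⟨c, hC.mono hcC⟩
  have hrec : y = 1 + y * x := by
    ext g
    by_cases hg : g ∈ C
    · exact hc g hg
    · have hy : y.coeff g = 0 := Function.notMem_support.1 fun h => hg (hcC h)
      have hone : (1 : MalcevNeumann K o).coeff g = 0 :=
        coeff_one_of_ne fun h => hg (h ▸ C.one_mem)
      have hyx : (y * x).coeff g = 0 := Function.notMem_support.1 fun h => hg <| by
        obtain ⟨a, ha, b, hb, rfl⟩ := support_mul_subset y x h
        exact C.mul_mem (hcC ha) (hxC hb)
      rw [coeff_add, hy, hone, hyx, add_zero]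
  refine ⟨y, hcC, ?_⟩
  rw [mul_sub, mul_one, sub_eq_iff_eq_add]
  exact hrec

section CompatibleOrder

variable [PartialOrder G] [MulLeftMono G] [MulRightMono G]

variable (K o) in
/-- The ring of series whose support is partially well-ordered for a partial order on `G` compatible
with the multiplication. -/
noncomputable def pwoSubring : Subring (MalcevNeumann K o) where
  carrier := {x | (Function.support x.coeff).IsPWO}
  zero_mem' := finite_empty.isPWO.mono fun _ hg => hg rfl
  one_mem' := (finite_singleton 1).isPWO.mono support_one_subset
  neg_mem' hx := hx.mono fun _ hg => neg_ne_zero.1 hg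
  add_mem' hx hy := (hx.union hy).mono (Function.support_add _ _)
  mul_mem' {x y} hx hy := (isPWO_mul hx hy).mono (support_mul_subset x y)

theorem single_mem_pwoSubring (g : G) (c : K) : single o g c ∈ pwoSubring K o :=
  (finite_singleton g).isPWO.mono (support_single_subset g c)

theorem exists_mem_pwoSubring_mul_one_sub_eq_one (hle : ∀ a b : G, a ≤ b → o.le a b)
    {x : MalcevNeumann K o} (hx : x ∈ pwoSubring K o)
    (hpos : ∀ g ∈ Function.support x.coeff, 1 < g) :
    ∃ y ∈ pwoSubring K o, y * (1 - x) = 1 := by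
  have hC := isPWO_submonoidClosure hx fun g hg => (hpos g hg).le
  obtain ⟨y, hyC, hy⟩ := exists_mul_one_sub_eq_one (BiOrder.wellOrdered_of_isPWO hle hC)
    Submonoid.subset_closure fun g hg => o.lt_of_le_of_ne (hle 1 g (hpos g hg).le) (hpos g hg).ne
  exact ⟨y, hC.mono hyC, hy⟩

theorem exists_mem_pwoSubring_mul_eq_one (hle : ∀ a b : G, a ≤ b → o.le a b)
    {x : MalcevNeumann K o} (hx : x ∈ pwoSubring K o) {g : G}
    (hg : IsLeast (Function.support x.coeff) g) : ∃ y ∈ pwoSubring K o, y * x = 1 := by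
  let u := single o g⁻¹ (x.coeff g)⁻¹
  have hu : u ∈ pwoSubring K o := single_mem_pwoSubring _ _
  have hux (h : G) : (u * x).coeff h = (x.coeff g)⁻¹ * x.coeff (g * h) := by
    rw [coeff_single_mul, inv_inv]
  have hpos : ∀ h ∈ Function.support (1 - u * x).coeff, 1 < h := by
    intro h hh
    rw [Function.mem_support, coeff_sub, hux] at hh
    have hne : h ≠ 1 := by
      rintro rfl
      rw [coeff_one_one, mul_one, inv_mul_cancel₀ hg.1, sub_self] at hh
      exact hh rfl
    rw [coeff_one_of_ne hne, zero_sub, neg_ne_zero] at hh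
    have hgh : g * 1 ≤ g * h := by
      rw [mul_one]
      exact hg.2 (right_ne_zero_of_mul hh)
    exact lt_of_le_of_ne (le_of_mul_le_mul_left' hgh) hne.symm
  obtain ⟨y, hy, hyx⟩ := exists_mem_pwoSubring_mul_one_sub_eq_one hle
    (sub_mem (one_mem _) (mul_mem hu hx)) hpos
  rw [sub_sub_cancel, ← mul_assoc] at hyx
  exact ⟨y * u, mul_mem hy hu, hyx⟩

end CompatibleOrder

variable (K o) in
/-- The set `K[N]⟨G/N⟩` as a ring, in terms of the order modulo `N`; see
`image_coeff_controlledSubring`. -/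
noncomputable def controlledSubring (N : Subgroup G) [N.Normal] : Subring (MalcevNeumann K o) :=
  letI := o.orderMod N
  haveI := o.orderMod_mulLeftMono N
  haveI := o.orderMod_mulRightMono N
  pwoSubring K o

variable {N M : Subgroup G} [N.Normal] [M.Normal]

theorem mem_controlledSubring {x : MalcevNeumann K o} : x ∈ controlledSubring K o N ↔
    (Function.support x.coeff).PartiallyWellOrderedOn (o.orderMod N).le :=
  Iff.rfl

theorem controlledSubring_le_of_le (hMN : M ≤ N) :
    controlledSubring K o N ≤ controlledSubring K o M := fun x hx => by
  have := PartiallyWellOrderedOn.image_of_monotone_on (f := id) (mem_controlledSubring.1 hx)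
    fun a _ b _ => BiOrder.orderMod_le_of_le hMN
  rwa [image_id] at this

theorem image_coeff_controlledSubring (hN : o.IsConvex N) :
    coeff '' (controlledSubring K o N : Set (MalcevNeumann K o)) = controlledSeries K o N := by
  refine Subset.antisymm ?_ fun f hf => ?_
  · rintro _ ⟨x, hx, rfl⟩
    exact mem_controlledSeries_of_partiallyWellOrderedOn_support hx
  · have hpwo := partiallyWellOrderedOn_support_of_mem_controlledSeries hN hf
    have hwo : o.WellOrdered (Function.support f) :=
      letI := o.orderMod N
      BiOrder.wellOrdered_of_isPWO (fun _ _ => BiOrder.le_of_orderMod_le) hpwo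
    exact ⟨⟨f, hwo⟩, hpwo, rfl⟩

theorem exists_mem_controlledSubring_mul_eq_one {x : MalcevNeumann K o}
    (hx : x ∈ controlledSubring K o N) {g : G} (hg : g ∈ Function.support x.coeff)
    (hmin : ∀ h ∈ Function.support x.coeff, (o.orderMod N).le g h) :
    ∃ y ∈ controlledSubring K o N, y * x = 1 :=
  letI := o.orderMod N
  haveI := o.orderMod_mulLeftMono N
  haveI := o.orderMod_mulRightMono N
  exists_mem_pwoSubring_mul_eq_one (fun _ _ => BiOrder.le_of_orderMod_le) hx ⟨hg, hmin⟩

end MalcevNeumann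

section ConvexFamily

variable {G : Type*} [Group G] {o : BiOrder G} {ι : Type*} {N : ι → Subgroup G}

theorem exists_le_forall_notMem_of_iInf_eq_bot (hN : Directed (· ≥ ·) N) (hbot : ⨅ i, N i = ⊥)
    {s : Set G} (hs : s.Finite) (hone : 1 ∉ s) (i : ι) : ∃ j, N j ≤ N i ∧ ∀ x ∈ s, x ∉ N j := by
  have : Nonempty ι := ⟨i⟩
  have hsep (x : G) (hx : x ∈ s) : ∃ k, x ∉ N k := by
    by_contra! h
    have : x ∈ ⨅ i, N i := Subgroup.mem_iInf.2 h
    rw [hbot, Subgroup.mem_bot] at this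
    exact hone (this ▸ hx)
  choose! k hk using hsep
  obtain ⟨j, hj⟩ := hN.finite_set_le ((hs.image k).insert i)
  exact ⟨j, hj i (mem_insert i _), fun x hx hxj =>
    hk x hx (hj (k x) (mem_insert_of_mem i (mem_image_of_mem k hx)) hxj)⟩

theorem directed_ge_of_isConvex (hN : ∀ i, o.IsConvex (N i)) : Directed (· ≥ ·) N := fun i j =>
  ((hN i).le_total (hN j)).elim (fun h => ⟨i, le_rfl, h⟩) fun h => ⟨j, h, le_rfl⟩

variable {K : Type*} [DivisionRing K] [∀ i, (N i).Normal]

theorem exists_mul_eq_one_of_mem_controlledSubring (hN : ∀ i, o.IsConvex (N i))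
    (hbot : ⨅ i, N i = ⊥) {x : MalcevNeumann K o} (hx0 : x ≠ 0) {i : ι}
    (hx : x ∈ MalcevNeumann.controlledSubring K o (N i)) :
    ∃ j, ∃ y ∈ MalcevNeumann.controlledSubring K o (N j), y * x = 1 := by
  obtain ⟨g, hg, hmin⟩ := MalcevNeumann.exists_isLeast_support hx0
  have hfin : {h ∈ Function.support x.coeff | h * g⁻¹ ∈ N i}.Finite :=
    BiOrder.finite_coset_of_partiallyWellOrderedOn_orderMod hx g
  obtain ⟨j, hji, hj⟩ := exists_le_forall_notMem_of_iInf_eq_bot (directed_ge_of_isConvex hN) hbot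
    ((hfin.image (· * g⁻¹)).sdiff (t := {1})) (fun h => h.2 rfl) i
  have hleast : ∀ h ∈ Function.support x.coeff, (o.orderMod (N j)).le g h := by
    intro h hh
    refine or_iff_not_imp_left.2 fun hne => (hN j).orderMod_lt
      (o.lt_of_le_of_ne (hmin h hh) hne) fun hmem => ?_
    exact hj _ ⟨⟨h, ⟨hh, hji hmem⟩, rfl⟩, fun h1 => hne (mul_inv_eq_one.1 h1).symm⟩ hmem
  exact ⟨j, MalcevNeumann.exists_mem_controlledSubring_mul_eq_one
    (MalcevNeumann.controlledSubring_le_of_le hji hx) hg hleast⟩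

theorem mainTheorem8_general [Nonempty ι] (hN : ∀ i, o.IsConvex (N i)) (hbot : ⨅ i, N i = ⊥) :
    ∃ D : Subring (MalcevNeumann K o),
      MalcevNeumann.coeff '' (D : Set (MalcevNeumann K o)) = ⋃ i, controlledSeries K o (N i) ∧
      Nontrivial D ∧
      ∀ x ∈ D, x ≠ 0 → ∃ y ∈ D, x * y = 1 ∧ y * x = 1 := by
  let D := ⨆ i, MalcevNeumann.controlledSubring K o (N i)
  have hD : (D : Set (MalcevNeumann K o)) = ⋃ i, MalcevNeumann.controlledSubring K o (N i) :=
    Subring.coe_iSup_of_directed fun i j => (directed_ge_of_isConvex hN i j).imp fun _ h =>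
      ⟨MalcevNeumann.controlledSubring_le_of_le h.1, MalcevNeumann.controlledSubring_le_of_le h.2⟩
  have hleft : ∀ x : D, x ≠ 0 → ∃ y : D, y * x = 1 := by
    rintro ⟨x, hxD⟩ hx0
    obtain ⟨i, hx⟩ := mem_iUnion.1 (hD.subset hxD)
    obtain ⟨j, y, hy, hyx⟩ := exists_mul_eq_one_of_mem_controlledSubring hN hbot
      (fun h => hx0 (Subtype.ext h)) hx
    exact ⟨⟨y, hD.superset (mem_iUnion.2 ⟨j, hy⟩)⟩, Subtype.ext hyx⟩
  refine ⟨D, ?_, inferInstance, fun x hxD hx0 => ?_⟩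
  · rw [hD, image_iUnion]
    exact iUnion_congr fun i => MalcevNeumann.image_coeff_controlledSubring (hN i)
  · have hx0' : (⟨x, hxD⟩ : D) ≠ 0 := fun h => hx0 (congrArg Subtype.val h)
    obtain ⟨y, hyx⟩ := hleft _ hx0'
    obtain ⟨z, hxz⟩ := exists_right_inv_of_exists_left_inv hleft hx0'
    obtain rfl := left_inv_eq_right_inv hyx hxz
    exact ⟨y, y.2, congrArg Subtype.val hxz, congrArg Subtype.val hyx⟩

end ConvexFamily

section Isolators

variable {G : Type*} [Group G] {P : ∀ n, BiOrder (IsolatorQuotient G n)}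

theorem IsolatorPos.of_inv_mul_mem {n : ℕ} {x y : G} (hx : IsolatorPos P x)
    (hn : x ∉ isolator G n) (hxy : x⁻¹ * y ∈ isolator G n) : IsolatorPos P y := by
  obtain ⟨i, hxi, -, h⟩ := hx
  have hin : i < n := lt_of_not_ge fun hni => hn (isolator_antitone hni hxi)
  have hyi : y ∈ isolator G i := by
    simpa using mul_mem hxi (isolator_antitone hin.le hxy)
  refine isolatorPos_intro hyi ?_
  rwa [← isolatorQuotient_mk_eq hxi hyi (isolator_antitone hin hxy)]

theorem isConvex_isolator (hG : IsResiduallyTorsionFreeNilpotent G) (n : ℕ) :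
    (isolatorOrder hG P).IsConvex (isolator G n) := by
  let _ := (isolatorOrder hG P).toLinearOrder
  refine ⟨fun x hx y hy z ⟨hxz, hzy⟩ => ?_⟩
  rcases hxz with rfl | hxz
  · exact hx
  rcases hzy with rfl | hzy
  · exact hy
  by_contra hz
  have hnot : z⁻¹ * y ∉ isolator G n := fun h => hz (by simpa using mul_mem hy (inv_mem h))
  -- `z⁻¹ * y` and `(x⁻¹ * z)⁻¹` lie in the same coset of the isolator, hence have the same sign.
  have hinv : IsolatorPos P (x⁻¹ * z)⁻¹ := by
    refine hzy.of_inv_mul_mem hnot ?_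
    simpa [mul_assoc] using mul_mem (inv_mem hy) hx
  exact not_isolatorPos_one (P := P) (by simpa using hxz.mul hinv)

theorem IsResiduallyTorsionFreeNilpotent.iInf_isolator (hG : IsResiduallyTorsionFreeNilpotent G) :
    ⨅ n, isolator G n = ⊥ := by
  refine eq_bot_iff.2 fun x hx => by_contra fun hne => ?_
  obtain ⟨n, hn⟩ := hG.exists_notMem_isolator hne
  exact hn (Subgroup.mem_iInf.1 hx n)

end Isolators

theorem mainTheorem8 {G : Type*} [Group G] [Group.FG G]
    (hG : IsResiduallyTorsionFreeNilpotent G) (P : ∀ n, BiOrder (IsolatorQuotient G n)) :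
    ∃ D : Subring (MalcevNeumann ℚ (isolatorOrder hG P)),
      MalcevNeumann.coeff '' (D : Set (MalcevNeumann ℚ (isolatorOrder hG P))) =
        eizenbudLichtman (isolatorOrder hG P) ∧
      Nontrivial D ∧
      ∀ x ∈ D, x ≠ 0 → ∃ y ∈ D, x * y = 1 ∧ y * x = 1 :=
  mainTheorem8_general (isConvex_isolator hG) hG.iInf_isolator
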